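/- Let $\omega$ be a symplectic form on $\mathbb{R}^4$ (a nondegenerate alternating bilinear form), written $\omega(x,y)=x^T\Omega y$ with $\Omega$ skew-symmetric and invertible, and let $H$ be a quadratic form on $\mathbb{R}^4$, written $H(x)=x^TSx$ with $S$ symmetric. Assume that $S$ is invertible and that $H$ has signature $0$, i.e. as many positive as negative squares. Let $L=\Omega^{-1}S$ be the matrix of the linear Hamiltonian system $\dot x=Lx$. The eigenvalues of $L$ are its complex eigenvalues, counted with algebraic multiplicity; the system is called elliptic if all of them are purely imaginary, and hyperbolic if none of them is purely imaginary. The nilpotent part of $L$ is the nilpotent summand $N$ in the Jordan–Chevalley decomposition $L=L_s+N$ (with $L_s$ semisimple, $N$ nilpotent, $L_sN=NL_s$). A Lagrangian plane is a two-dimensional linear subspace of $\mathbb{R}^4$ on which $\omega$ vanishes identically, and $\mathcal{N}=H^{-1}(0)$ is the null-cone of $H$. Then: 1. if the system is elliptic and all eigenvalues of $L$ are simple, then $\mathcal{N}$ contains no Lagrangian plane; 2. if the system is elliptic, all eigenvalues of $L$ have algebraic multiplicity two and the nilpotent part of $L$ is nonzero, then $\mathcal{N}$ contains precisely $1$ Lagrangian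 plane; 3. if the system is hyperbolic and the eigenvalues of $L$ form a complex quadruplet $\kappa\pm i\nu$, $-\kappa\pm i\nu$ with $\kappa,\nu\in\mathbb{R}\setminus\{0\}$, then $\mathcal{N}$ contains precisely $2$ Lagrangian planes; 4. if the system is hyperbolic, all eigenvalues of $L$ are real and have algebraic multiplicity two, and the nilpotent part of $L$ is nonzero, then $\mathcal{N}$ contains precisely $3$ Lagrangian planes; 5. if the system is hyperbolic and all eigenvalues of $L$ are real and simple, then $\mathcal{N}$ contains precisely $4$ Lagrangian planes. -/

import Mathlib

namespace LinHam

noncomputable section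

/-- The matrix `L = Ω⁻¹ S` of the linear system `ẋ = L x`, where `ω(x, y) = xᵀ Ω y` and
`H(x) = xᵀ S x` with `S` symmetric. -/
def systemMatrix (ω : LinearMap.BilinForm ℝ (Fin 4 → ℝ)) (H : QuadraticForm ℝ (Fin 4 → ℝ)) :
    Matrix (Fin 4) (Fin 4) ℝ :=
  (LinearMap.toMatrix₂' ℝ ω)⁻¹ * H.toMatrix'

/-- The complex eigenvalues of a real `4 × 4` matrix, with algebraic multiplicity. -/
def eigenvalues (L : Matrix (Fin 4) (Fin 4) ℝ) : Multiset ℂ :=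
  (L.map (algebraMap ℝ ℂ)).charpoly.roots

/-- All eigenvalues are purely imaginary. -/
def IsElliptic (L : Matrix (Fin 4) (Fin 4) ℝ) : Prop :=
  ∀ μ ∈ eigenvalues L, μ.re = 0

/-- No eigenvalue is purely imaginary. -/
def IsHyperbolic (L : Matrix (Fin 4) (Fin 4) ℝ) : Prop :=
  ∀ μ ∈ eigenvalues L, μ.re ≠ 0

/-- All eigenvalues are real. -/
def HasRealEigenvalues (L : Matrix (Fin 4) (Fin 4) ℝ) : Prop :=
  ∀ μ ∈ eigenvalues L, μ.im = 0

/-- All eigenvalues have algebraic multiplicity one. -/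
def HasSimpleEigenvalues (L : Matrix (Fin 4) (Fin 4) ℝ) : Prop :=
  (eigenvalues L).Nodup

/-- All eigenvalues have algebraic multiplicity two. -/
def HasDoubleEigenvalues (L : Matrix (Fin 4) (Fin 4) ℝ) : Prop :=
  ∀ μ ∈ eigenvalues L, (eigenvalues L).count μ = 2

/-- The eigenvalues are `κ ± iν`, `-κ ± iν` with `κ` and `ν` nonzero reals. -/
def HasComplexQuadruplet (L : Matrix (Fin 4) (Fin 4) ℝ) : Prop :=
  ∃ κ ν : ℝ, κ ≠ 0 ∧ ν ≠ 0 ∧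
    eigenvalues L = {(⟨κ, ν⟩ : ℂ), (⟨κ, -ν⟩ : ℂ), (⟨-κ, ν⟩ : ℂ), (⟨-κ, -ν⟩ : ℂ)}

/-- The nilpotent part in the Jordan–Chevalley decomposition of `L` (the sum of commuting
semisimple and nilpotent endomorphisms, which exists and is unique over `ℝ`) is nonzero. -/
def HasNonzeroNilpotentPart (L : Matrix (Fin 4) (Fin 4) ℝ) : Prop :=
  ∃ s n : Module.End ℝ (Fin 4 → ℝ), s.IsSemisimple ∧ IsNilpotent n ∧ Commute s n ∧
    Matrix.toLin' L = s + n ∧ n ≠ 0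

/-- The null-cone `H⁻¹(0)`. -/
def nullCone (H : QuadraticForm ℝ (Fin 4 → ℝ)) : Set (Fin 4 → ℝ) :=
  {x | H x = 0}

/-- A Lagrangian plane of a symplectic form on `ℝ⁴`: a two-dimensional subspace on which the
form vanishes. -/
def IsLagrangianPlane (ω : LinearMap.BilinForm ℝ (Fin 4 → ℝ))
    (P : Submodule ℝ (Fin 4 → ℝ)) : Prop :=
  Module.finrank ℝ P = 2 ∧ ∀ x ∈ P, ∀ y ∈ P, ω x y = 0

/-- The set of Lagrangian planes contained in the null-cone of `H`. -/
def lagrangianPlanesInNullCone (ω : LinearMap.BilinForm ℝ (Fin 4 → ℝ))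
    (H : QuadraticForm ℝ (Fin 4 → ℝ)) : Set (Submodule ℝ (Fin 4 → ℝ)) :=
  {P | IsLagrangianPlane ω P ∧ (P : Set (Fin 4 → ℝ)) ⊆ nullCone H}

end

end LinHam

/-
A Lagrangian plane lies in the null-cone of `H` if and only if it is invariant under `L`, which is
skew-adjoint for `ω`. Let `f` be skew-adjoint with minimal polynomial `p` of full degree. Then
`q ↦ ker q(f)` is a bijection from the factorizations `p(X) = ± q(X) q(-X)` onto the invariant
Lagrangian subspaces: `ker q(f)` is the image of `q(-X)(f)`, the adjoint of `q(f)`, and is therefore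
its own `ω`-orthogonal. In dimension four `p = X⁴ - σX² + δ`, and it remains to count its
factorizations `(X² + bX + c)(X² - bX + c)`, i.e. the real solutions of `b² - 2c = σ`, `c² = δ`.
-/

namespace LinHam

open Polynomial Module Matrix

section Factors

variable {R : Type*} [CommRing R]

theorem coeff_comp_neg_X (p : R[X]) (n : ℕ) : (p.comp (-X)).coeff n = (-1) ^ n * p.coeff n := by
  rw [show (-X : R[X]) = C (-1) * X by simp, comp_C_mul_X_coeff, mul_comm]

variable {K : Type*} [Field K]

/-- The monic polynomials `q` for which `q(X) q(-X)` equals `p` up to a unit. For monic `p` the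
unit is the sign `(-1) ^ deg q`. -/
def reflectionFactors (p : K[X]) : Set K[X] :=
  {q | q.Monic ∧ Associated (q * q.comp (-X)) p}

/-- The pairs `(b, c)` for which `(X² + bX + c)(X² - bX + c) = X⁴ - σX² + δ`. They parametrize
`reflectionFactors` of this quartic. -/
def quarticReflectionFactors (σ δ : R) : Set (R × R) :=
  {x | x.1 ^ 2 - 2 * x.2 = σ ∧ x.2 ^ 2 = δ}

theorem eq_quadratic_of_monic {q : R[X]} (hq : q.Monic) (hdeg : q.natDegree = 2) :
    q = X ^ 2 + C (q.coeff 1) * X + C (q.coeff 0) := by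
  have hlead : q.coeff 2 = 1 := hdeg ▸ hq.coeff_natDegree
  conv_lhs => rw [q.as_sum_range_C_mul_X_pow, hdeg]
  simp only [Finset.sum_range_succ, Finset.sum_range_zero, hlead, map_one]
  ring

theorem coeff_eq_zero_of_dvd_comp_neg_X [NoZeroDivisors R] (h2 : (2 : R) ≠ 0) {p : R[X]}
    (hp : p.Monic) (hdvd : p ∣ p.comp (-X)) {n : ℕ} (hn : Odd (p.natDegree + n)) :
    p.coeff n = 0 := by
  have hdeg : ((-1) ^ p.natDegree * p.comp (-X)).natDegree = p.natDegree := by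
    rcases neg_one_pow_eq_or R[X] p.natDegree with h | h <;>
      simp [h, natDegree_eq_of_degree_eq degree_comp_neg_X]
  have hparity : (-1) ^ p.natDegree * p.comp (-X) = p :=
    eq_of_monic_of_dvd_of_natDegree_le hp hp.neg_one_pow_natDegree_mul_comp_neg_X
      (hdvd.mul_left _) hdeg.le
  have hcoeff : (-1) ^ (p.natDegree + n) * p.coeff n = p.coeff n := by
    conv_rhs => rw [← hparity, ← C_1, ← C_neg, ← C_pow, coeff_C_mul, coeff_comp_neg_X]
    ring
  rw [hn.neg_one_pow] at hcoeff
  have h : 2 * p.coeff n = 0 := by linear_combination -hcoeff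
  exact (mul_eq_zero.1 h).resolve_left h2

theorem eq_quartic_of_monic_of_dvd_comp_neg_X [NoZeroDivisors R] (h2 : (2 : R) ≠ 0) {p : R[X]}
    (hp : p.Monic) (hdeg : p.natDegree = 4) (hdvd : p ∣ p.comp (-X)) :
    p = X ^ 4 - C (-p.coeff 2) * X ^ 2 + C (p.coeff 0) := by
  have hlead : p.coeff 4 = 1 := hdeg ▸ hp.coeff_natDegree
  have hthree : p.coeff 3 = 0 :=
    coeff_eq_zero_of_dvd_comp_neg_X h2 hp hdvd (by rw [hdeg]; decide)
  have hone : p.coeff 1 = 0 :=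
    coeff_eq_zero_of_dvd_comp_neg_X h2 hp hdvd (by rw [hdeg]; decide)
  conv_lhs => rw [p.as_sum_range_C_mul_X_pow, hdeg]
  simp only [Finset.sum_range_succ, Finset.sum_range_zero, hlead, hthree, hone, map_one, map_zero,
    map_neg]
  ring

theorem quadratic_mul_comp_neg_X (b c : R) :
    (X ^ 2 + C b * X + C c) * (X ^ 2 + C b * X + C c).comp (-X) =
      X ^ 4 - C (b ^ 2 - 2 * c) * X ^ 2 + C (c ^ 2) := by
  simp only [add_comp, mul_comp, pow_comp, X_comp, C_comp, C_sub, C_mul, C_pow, C_ofNat]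
  ring

theorem quartic_inj {σ δ σ' δ' : R} : X ^ 4 - C σ * X ^ 2 + C δ = X ^ 4 - C σ' * X ^ 2 + C δ' ↔
    σ = σ' ∧ δ = δ' := by
  refine ⟨fun h => ⟨?_, ?_⟩, fun ⟨hσ, hδ⟩ => hσ ▸ hδ ▸ rfl⟩
  · simpa [coeff_X_pow, coeff_C] using congrArg (coeff · 2) h
  · simpa [coeff_X_pow, coeff_C] using congrArg (coeff · 0) h

theorem reflectionFactors_quartic (σ δ : K) :
    reflectionFactors (X ^ 4 - C σ * X ^ 2 + C δ) =
      (fun x : K × K => X ^ 2 + C x.1 * X + C x.2) '' quarticReflectionFactors σ δ := by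
  have hmonic : (X ^ 4 - C σ * X ^ 2 + C δ).Monic := by monicity!
  have hdegree : (X ^ 4 - C σ * X ^ 2 + C δ).natDegree = 4 := by compute_degree!
  ext q
  constructor
  · rintro ⟨hq, hassoc⟩
    have hdeg : q.natDegree = 2 := by
      have h := natDegree_eq_of_degree_eq (degree_eq_degree_of_associated hassoc)
      rw [natDegree_mul hq.ne_zero (comp_neg_X_eq_zero_iff.not.2 hq.ne_zero), natDegree_comp,
        natDegree_neg, natDegree_X, hdegree] at h
      lia
    rw [eq_quadratic_of_monic hq hdeg, quadratic_mul_comp_neg_X] at hassoc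
    exact ⟨(q.coeff 1, q.coeff 0),
      quartic_inj.1 (eq_of_monic_of_associated (by monicity!) hmonic hassoc),
      (eq_quadratic_of_monic hq hdeg).symm⟩
  · rintro ⟨⟨b, c⟩, ⟨hσ, hδ⟩, rfl⟩
    dsimp only at hσ hδ ⊢
    exact ⟨by monicity!, by rw [quadratic_mul_comp_neg_X, hσ, hδ]⟩

theorem encard_reflectionFactors_quartic (σ δ : K) :
    (reflectionFactors (X ^ 4 - C σ * X ^ 2 + C δ)).encard =
      (quarticReflectionFactors σ δ).encard := by
  rw [reflectionFactors_quartic]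
  refine Function.Injective.encard_image (fun x y h => Prod.ext ?_ ?_) _
  · simpa [coeff_X_pow, coeff_C] using congrArg (coeff · 1) h
  · simpa [coeff_X_pow, coeff_C] using congrArg (coeff · 0) h

theorem quarticReflectionFactors_sq_add_sq [NoZeroDivisors R] (a b : R) :
    quarticReflectionFactors (a ^ 2 + b ^ 2) (a ^ 2 * b ^ 2) =
      {(a + b, a * b), (-(a + b), a * b), (a - b, -(a * b)), (-(a - b), -(a * b))} := by
  ext ⟨β, γ⟩
  simp only [quarticReflectionFactors, Set.mem_ofPred_eq, Set.mem_insert_iff,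
    Set.mem_singleton_iff, Prod.mk.injEq]
  constructor
  · rintro ⟨hβ, hγ⟩
    rcases sq_eq_sq_iff_eq_or_eq_neg.1 (hγ.trans (mul_pow a b 2).symm) with rfl | rfl
    · have h : β ^ 2 = (a + b) ^ 2 := by linear_combination hβ
      have := sq_eq_sq_iff_eq_or_eq_neg.1 h
      tauto
    · have h : β ^ 2 = (a - b) ^ 2 := by linear_combination hβ
      have := sq_eq_sq_iff_eq_or_eq_neg.1 h
      tauto
  · rintro (⟨rfl, rfl⟩ | ⟨rfl, rfl⟩ | ⟨rfl, rfl⟩ | ⟨rfl, rfl⟩) <;> constructor <;> ring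

theorem ne_neg_of_two_ne_zero [NoZeroDivisors R] (h2 : (2 : R) ≠ 0) {a : R} (ha : a ≠ 0) :
    a ≠ -a :=
  fun h => mul_ne_zero h2 ha (by linear_combination h)

theorem encard_quarticReflectionFactors_eq_four [NoZeroDivisors R] (h2 : (2 : R) ≠ 0) {a b : R}
    (ha : a ≠ 0) (hb : b ≠ 0) (hab : a ^ 2 ≠ b ^ 2) :
    (quarticReflectionFactors (a ^ 2 + b ^ 2) (a ^ 2 * b ^ 2)).encard = 4 := by
  have hprod : a * b ≠ -(a * b) := ne_neg_of_two_ne_zero h2 (mul_ne_zero ha hb)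
  have hsum : a + b ≠ -(a + b) :=
    ne_neg_of_two_ne_zero h2 fun h => hab (by linear_combination (a - b) * h)
  have hdiff : a - b ≠ -(a - b) :=
    ne_neg_of_two_ne_zero h2 fun h => hab (by linear_combination (a + b) * h)
  rw [quarticReflectionFactors_sq_add_sq, Set.encard_insert_of_notMem, Set.encard_insert_of_notMem,
    Set.encard_pair]
  · norm_num
  all_goals
    simp only [Set.mem_insert_iff, Set.mem_singleton_iff, Prod.mk.injEq, ne_eq]
    tauto

theorem encard_quarticReflectionFactors_eq_three [NoZeroDivisors R] (h2 : (2 : R) ≠ 0) {a : R}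
    (ha : a ≠ 0) :
    (quarticReflectionFactors (a ^ 2 + a ^ 2) (a ^ 2 * a ^ 2)).encard = 3 := by
  have hprod : a * a ≠ -(a * a) := ne_neg_of_two_ne_zero h2 (mul_ne_zero ha ha)
  have hsum : a + a ≠ -(a + a) := ne_neg_of_two_ne_zero h2 (two_mul a ▸ mul_ne_zero h2 ha)
  rw [quarticReflectionFactors_sq_add_sq, sub_self, neg_zero, Set.pair_eq_singleton,
    Set.encard_insert_of_notMem, Set.encard_pair]
  · norm_num
  all_goals
    simp only [Set.mem_insert_iff, Set.mem_singleton_iff, Prod.mk.injEq, ne_eq]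
    tauto

section Order

variable {R : Type*} [CommRing R] [LinearOrder R] [IsStrictOrderedRing R]

theorem encard_quarticReflectionFactors_eq_two {κ ν : R} (hκ : κ ≠ 0) (hν : ν ≠ 0) :
    (quarticReflectionFactors (2 * (κ ^ 2 - ν ^ 2)) ((κ ^ 2 + ν ^ 2) ^ 2)).encard = 2 := by
  have hpairs : quarticReflectionFactors (2 * (κ ^ 2 - ν ^ 2)) ((κ ^ 2 + ν ^ 2) ^ 2) =
      {(2 * κ, κ ^ 2 + ν ^ 2), (-(2 * κ), κ ^ 2 + ν ^ 2)} := by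
    ext ⟨β, γ⟩
    simp only [quarticReflectionFactors, Set.mem_ofPred_eq, Set.mem_insert_iff,
      Set.mem_singleton_iff, Prod.mk.injEq]
    constructor
    · rintro ⟨hβ, hγ⟩
      rcases sq_eq_sq_iff_eq_or_eq_neg.1 hγ with rfl | rfl
      · have h : β ^ 2 = (2 * κ) ^ 2 := by linear_combination hβ
        have := sq_eq_sq_iff_eq_or_eq_neg.1 h
        tauto
      · nlinarith [sq_nonneg β, sq_pos_of_ne_zero hν]
    · rintro (⟨rfl, rfl⟩ | ⟨rfl, rfl⟩) <;> constructor <;> ring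
  rw [hpairs, Set.encard_pair]
  simpa [self_eq_neg] using hκ

theorem quarticReflectionFactors_neg_sq {a : R} (ha : a ≠ 0) :
    quarticReflectionFactors (-a ^ 2 + -a ^ 2) (-a ^ 2 * -a ^ 2) = {(0, a ^ 2)} := by
  ext ⟨β, γ⟩
  simp only [quarticReflectionFactors, Set.mem_ofPred_eq, Set.mem_singleton_iff, Prod.mk.injEq]
  constructor
  · rintro ⟨hβ, hγ⟩
    rcases sq_eq_sq_iff_eq_or_eq_neg.1 (hγ.trans (by ring : _ = (a ^ 2) ^ 2)) with rfl | rfl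
    · exact ⟨pow_eq_zero_iff two_ne_zero |>.1 (by linear_combination hβ), rfl⟩
    · nlinarith [sq_nonneg β, sq_pos_of_ne_zero ha]
  · rintro ⟨rfl, rfl⟩
    constructor <;> ring

theorem quarticReflectionFactors_neg_sq_eq_empty {a b : R} (hab : a ^ 2 ≠ b ^ 2) :
    quarticReflectionFactors (-a ^ 2 + -b ^ 2) (-a ^ 2 * -b ^ 2) = ∅ := by
  refine Set.eq_empty_iff_forall_notMem.2 ?_
  rintro ⟨β, γ⟩ ⟨hβ, hγ⟩
  have hγ' : γ ^ 2 = (a * b) ^ 2 := by linear_combination hγ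
  rcases sq_eq_sq_iff_eq_or_eq_neg.1 hγ' with rfl | rfl
  · have h : (a - b) ^ 2 = -β ^ 2 := by linear_combination hβ
    have hdiff : a - b = 0 := sq_nonpos_iff _ |>.1 (h ▸ neg_nonpos.2 (sq_nonneg β))
    exact hab (by linear_combination (a + b) * hdiff)
  · have h : (a + b) ^ 2 = -β ^ 2 := by linear_combination hβ
    have hsum : a + b = 0 := sq_nonpos_iff _ |>.1 (h ▸ neg_nonpos.2 (sq_nonneg β))
    exact hab (by linear_combination (a - b) * hsum)

end Order

end Factors

section LinearAlgebra

variable {K V : Type*} [Field K] [AddCommGroup V] [Module K V]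
  {ω : LinearMap.BilinForm K V} {f : End K V}

theorem coe_aeval_restrict_apply {P : Submodule K V} (hP : P ∈ f.invtSubmodule) (p : K[X])
    (x : P) : (aeval (f.restrict hP) p x : V) = aeval f p x := by
  induction p using Polynomial.induction_on' with
  | add p q hp hq => simp [hp, hq]
  | monomial n a => simp [aeval_monomial, End.pow_restrict n hP]

theorem aeval_charpoly_restrict_apply [FiniteDimensional K V] {P : Submodule K V}
    (hP : P ∈ f.invtSubmodule) {x : V} (hx : x ∈ P) :
    aeval f (LinearMap.charpoly (f.restrict hP : End K P)) x = 0 := by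
  rw [← coe_aeval_restrict_apply hP _ ⟨x, hx⟩, LinearMap.aeval_self_charpoly,
    LinearMap.zero_apply, ZeroMemClass.coe_zero]

theorem range_aeval_mem_invtSubmodule (p : K[X]) :
    LinearMap.range (aeval f p) ∈ f.invtSubmodule := by
  have hcomm : Commute f (aeval f p) := by simpa using (commute_X p).map (aeval f)
  rintro _ ⟨x, rfl⟩
  exact ⟨f x, (LinearMap.congr_fun hcomm.eq x).symm⟩

theorem natDegree_le_finrank_range_aeval [FiniteDimensional K V] {q r : K[X]} (hq : q ≠ 0)
    (h : q * r ∣ minpoly K f) : r.natDegree ≤ finrank K (LinearMap.range (aeval f q)) := by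
  have hinv : LinearMap.range (aeval f q) ∈ f.invtSubmodule := range_aeval_mem_invtSubmodule q
  let g : End K (LinearMap.range (aeval f q)) := f.restrict hinv
  have hann : aeval f (q * g.charpoly) = 0 := by
    ext x
    rw [mul_comm, map_mul, End.mul_apply, LinearMap.zero_apply]
    exact aeval_charpoly_restrict_apply hinv ⟨x, rfl⟩
  have hdvd : r ∣ g.charpoly := (mul_dvd_mul_iff_left hq).1 (h.trans (minpoly.dvd K f hann))
  exact (natDegree_le_of_dvd hdvd g.charpoly_monic.ne_zero).trans_eq g.charpoly_natDegree

theorem ker_aeval_eq_range_aeval [FiniteDimensional K V]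
    (hf : (minpoly K f).natDegree = finrank K V) {q r : K[X]}
    (h : Associated (q * r) (minpoly K f)) :
    LinearMap.ker (aeval f q) = LinearMap.range (aeval f r) := by
  have hne : q * r ≠ 0 := h.ne_zero_iff.2 (minpoly.ne_zero (Algebra.IsIntegral.isIntegral f))
  have hdeg : q.natDegree + r.natDegree = finrank K V := by
    rw [← natDegree_mul (left_ne_zero_of_mul hne) (right_ne_zero_of_mul hne), ← hf]
    exact natDegree_eq_of_degree_eq (degree_eq_degree_of_associated h)
  have hle : LinearMap.range (aeval f r) ≤ LinearMap.ker (aeval f q) := by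
    rw [LinearMap.range_le_ker_iff, ← End.mul_eq_comp, ← map_mul]
    exact aeval_eq_zero_of_dvd_aeval_eq_zero h.symm.dvd (minpoly.aeval K f)
  have hrangeq : r.natDegree ≤ finrank K (LinearMap.range (aeval f q)) :=
    natDegree_le_finrank_range_aeval (left_ne_zero_of_mul hne) h.dvd
  have hranger : q.natDegree ≤ finrank K (LinearMap.range (aeval f r)) :=
    natDegree_le_finrank_range_aeval (right_ne_zero_of_mul hne) (mul_comm q r ▸ h.dvd)
  have hrank := (aeval f q).finrank_range_add_finrank_ker
  exact (Submodule.eq_of_le_of_finrank_le hle (by lia)).symm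

theorem isAdjointPair_aeval {g : End K V} (h : LinearMap.IsAdjointPair ω ω f g) (p : K[X]) :
    LinearMap.IsAdjointPair ω ω (aeval f p) (aeval g p) := by
  have hpow : ∀ (n : ℕ) (x y : V), ω ((f ^ n) x) y = ω x ((g ^ n) y) := by
    intro n
    induction n with
    | zero => exact fun _ _ => rfl
    | succ n ih =>
      intro x y
      rw [pow_succ, pow_succ', End.mul_apply, End.mul_apply, ih, h]
  intro x y
  simp [aeval_endomorphism, Polynomial.sum_def, hpow]

theorem isAdjointPair_aeval_comp_neg_X (hf : ω.IsSkewAdjoint f) (p : K[X]) :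
    LinearMap.IsAdjointPair ω ω (aeval f (p.comp (-X))) (aeval f p) := by
  have haeval : aeval (-f) (p.comp (-X)) = aeval f p := by simp [aeval_comp]
  exact haeval ▸ isAdjointPair_aeval (g := -f) hf (p.comp (-X))

theorem ker_eq_orthogonal_range {g : End K V} (hω : ω.Nondegenerate)
    (h : LinearMap.IsAdjointPair ω ω f g) : LinearMap.ker g = ω.orthogonal (LinearMap.range f) := by
  ext y
  refine ⟨?_, fun hy => hω.2 _ fun x => ?_⟩
  · rintro hy _ ⟨x, rfl⟩
    exact (h x y).trans (by rw [hy, map_zero])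
  · rw [← h]
    exact hy _ ⟨x, rfl⟩

variable (ω f) in
/-- The `f`-invariant subspaces that are Lagrangian for `ω`, in the sense that they are equal to
their own `ω`-orthogonal. -/
def lagrangianInvtSubmodules : Set (Submodule K V) :=
  {P | P ∈ f.invtSubmodule ∧ ω.orthogonal P = P}

theorem ker_aeval_mem_lagrangianInvtSubmodules [FiniteDimensional K V] (hω : ω.Nondegenerate)
    (hf : ω.IsSkewAdjoint f) (hdeg : (minpoly K f).natDegree = finrank K V) {q : K[X]}
    (hq : q ∈ reflectionFactors (minpoly K f)) :
    LinearMap.ker (aeval f q) ∈ lagrangianInvtSubmodules ω f := by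
  have hker := ker_aeval_eq_range_aeval hdeg hq.2
  refine ⟨hker ▸ range_aeval_mem_invtSubmodule _, ?_⟩
  conv_rhs => rw [ker_eq_orthogonal_range hω (isAdjointPair_aeval_comp_neg_X hf q)]
  rw [hker]

theorem dvd_of_ker_aeval_le_ker_aeval [FiniteDimensional K V]
    (hdeg : (minpoly K f).natDegree = finrank K V) {p q r : K[X]}
    (hr : Associated (q * r) (minpoly K f))
    (hle : LinearMap.ker (aeval f q) ≤ LinearMap.ker (aeval f p)) : q ∣ p := by
  have hr0 : r ≠ 0 := right_ne_zero_of_mul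
    (hr.ne_zero_iff.2 (minpoly.ne_zero (Algebra.IsIntegral.isIntegral f)))
  rw [ker_aeval_eq_range_aeval hdeg hr, LinearMap.range_le_ker_iff, ← End.mul_eq_comp,
    ← map_mul] at hle
  exact (mul_dvd_mul_iff_right hr0).1 (hr.dvd.trans (minpoly.dvd K f hle))

theorem injOn_ker_aeval [FiniteDimensional K V] (hdeg : (minpoly K f).natDegree = finrank K V) :
    Set.InjOn (fun q => LinearMap.ker (aeval f q)) (reflectionFactors (minpoly K f)) :=
  fun _ hp _ hq h => eq_of_monic_of_associated hp.1 hq.1 <| associated_of_dvd_dvd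
    (dvd_of_ker_aeval_le_ker_aeval hdeg hp.2 h.le) (dvd_of_ker_aeval_le_ker_aeval hdeg hq.2 h.ge)

theorem charpoly_restrict_mem_reflectionFactors [FiniteDimensional K V] (hω : ω.Nondegenerate)
    (hf : ω.IsSkewAdjoint f) (hdeg : (minpoly K f).natDegree = finrank K V) {P : Submodule K V}
    (hinv : P ∈ f.invtSubmodule) (horth : ω.orthogonal P = P) :
    LinearMap.charpoly (f.restrict hinv : End K P) ∈ reflectionFactors (minpoly K f) := by
  set q := LinearMap.charpoly (f.restrict hinv : End K P)
  have hq : q.Monic := LinearMap.charpoly_monic _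
  have hcomp : q.comp (-X) ≠ 0 := comp_neg_X_eq_zero_iff.not.2 hq.ne_zero
  have hle : P ≤ LinearMap.ker (aeval f q) := fun x hx => aeval_charpoly_restrict_apply hinv hx
  have hrange : LinearMap.range (aeval f (q.comp (-X))) ≤ P := by
    rintro _ ⟨z, rfl⟩
    rw [← horth]
    intro x hx
    have hadj := isAdjointPair_aeval_comp_neg_X hf (q.comp (-X)) x z
    rw [comp_neg_X_comp_neg_X, hle hx, map_zero] at hadj
    exact hadj.symm
  have hdvd : minpoly K f ∣ q * q.comp (-X) := by
    refine minpoly.dvd K f ?_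
    rw [map_mul, End.mul_eq_comp, ← LinearMap.range_le_ker_iff]
    exact hrange.trans hle
  have hqdeg : (q * q.comp (-X)).natDegree = 2 * finrank K P := by
    rw [natDegree_mul hq.ne_zero hcomp, natDegree_comp, natDegree_neg, natDegree_X, mul_one,
      ← two_mul, LinearMap.charpoly_natDegree]
  have hfin := LinearMap.BilinForm.finrank_orthogonal hω P
  have hPle := P.finrank_le
  rw [horth] at hfin
  exact ⟨hq, (associated_of_dvd_of_natDegree_le hdvd (mul_ne_zero hq.ne_zero hcomp)
    (by lia)).symm⟩

theorem surjOn_ker_aeval [FiniteDimensional K V] (hω : ω.Nondegenerate)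
    (hf : ω.IsSkewAdjoint f) (hdeg : (minpoly K f).natDegree = finrank K V) :
    Set.SurjOn (fun q => LinearMap.ker (aeval f q)) (reflectionFactors (minpoly K f))
      (lagrangianInvtSubmodules ω f) := by
  rintro P ⟨hinv, horth⟩
  have hq := charpoly_restrict_mem_reflectionFactors hω hf hdeg hinv horth
  have hle : P ≤ LinearMap.ker (aeval f (LinearMap.charpoly (f.restrict hinv : End K P))) :=
    fun _ hx => aeval_charpoly_restrict_apply hinv hx
  refine ⟨_, hq, le_antisymm ?_ hle⟩
  calc LinearMap.ker (aeval f (LinearMap.charpoly (f.restrict hinv : End K P)))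
      = ω.orthogonal (LinearMap.ker (aeval f _)) :=
        (ker_aeval_mem_lagrangianInvtSubmodules hω hf hdeg hq).2.symm
    _ ≤ ω.orthogonal P := LinearMap.BilinForm.orthogonal_le hle
    _ = P := horth

theorem bijOn_ker_aeval [FiniteDimensional K V] (hω : ω.Nondegenerate)
    (hf : ω.IsSkewAdjoint f) (hdeg : (minpoly K f).natDegree = finrank K V) :
    Set.BijOn (fun q => LinearMap.ker (aeval f q)) (reflectionFactors (minpoly K f))
      (lagrangianInvtSubmodules ω f) :=
  ⟨fun _ => ker_aeval_mem_lagrangianInvtSubmodules hω hf hdeg, injOn_ker_aeval hdeg,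
    surjOn_ker_aeval hω hf hdeg⟩

theorem minpoly_dvd_minpoly_comp_neg_X (hω : ω.Nondegenerate) (hf : ω.IsSkewAdjoint f) :
    minpoly K f ∣ (minpoly K f).comp (-X) := by
  refine minpoly.dvd K f (LinearMap.ext fun x => hω.1 _ fun y => ?_)
  rw [isAdjointPair_aeval_comp_neg_X hf, minpoly.aeval, LinearMap.zero_apply, map_zero]

theorem natDegree_minpoly_eq_four [FiniteDimensional K V] (h2 : (2 : K) ≠ 0)
    (hV : finrank K V = 4) (hω : ω.Nondegenerate) (hf : ω.IsSkewAdjoint f)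
    (hinj : Function.Injective f) (hsq : ∀ c : K, c ≠ 0 → f * f ≠ c • 1) :
    (minpoly K f).natDegree = 4 := by
  have : Nontrivial V := nontrivial_of_finrank_pos (hV ▸ four_pos : 0 < finrank K V)
  have hint := Algebra.IsIntegral.isIntegral (R := K) f
  have hodd {n : ℕ} : Odd ((minpoly K f).natDegree + n) → (minpoly K f).coeff n = 0 :=
    coeff_eq_zero_of_dvd_comp_neg_X h2 (minpoly.monic hint) (minpoly_dvd_minpoly_comp_neg_X hω hf)
  have hconst : (minpoly K f).coeff 0 ≠ 0 := LinearMap.minpoly_coeff_zero_of_injective hinj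
  have heven : Even (minpoly K f).natDegree :=
    Nat.not_odd_iff_even.1 fun h => hconst (hodd h)
  have hpos : 0 < (minpoly K f).natDegree := minpoly.natDegree_pos hint
  have hle : (minpoly K f).natDegree ≤ 4 := by
    rw [← hV, ← f.charpoly_natDegree]
    exact natDegree_le_of_dvd f.minpoly_dvd_charpoly f.charpoly_monic.ne_zero
  have hne : (minpoly K f).natDegree ≠ 2 := by
    intro htwo
    have hann := minpoly.aeval K f
    rw [eq_quadratic_of_monic (minpoly.monic hint) htwo, hodd (by rw [htwo]; decide)] at hann
    refine hsq (-(minpoly K f).coeff 0) (neg_ne_zero.2 hconst) ?_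
    simpa [sq, Algebra.algebraMap_eq_smul_one, add_eq_zero_iff_eq_neg] using hann
  obtain ⟨k, hk⟩ := heven
  lia

theorem encard_lagrangianInvtSubmodules [FiniteDimensional K V] (h2 : (2 : K) ≠ 0)
    (hV : finrank K V = 4) (hω : ω.Nondegenerate) (hf : ω.IsSkewAdjoint f) {σ δ : K}
    (hchar : f.charpoly = X ^ 4 - C σ * X ^ 2 + C δ) (hδ : δ ≠ 0)
    (hsq : ∀ c : K, c ≠ 0 → f * f ≠ c • 1) :
    (lagrangianInvtSubmodules ω f).encard = (quarticReflectionFactors σ δ).encard := by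
  have hinj : Function.Injective f := by
    refine LinearMap.ker_eq_bot.1 ((Submodule.eq_bot_iff _).2 fun x hx => ?_)
    by_contra hx0
    have hconst := f.charpoly_constantCoeff_eq_zero_iff.2 ⟨x, hx0, hx⟩
    exact hδ (by simpa [hchar] using hconst)
  have hdeg : (minpoly K f).natDegree = finrank K V :=
    (natDegree_minpoly_eq_four h2 hV hω hf hinj hsq).trans hV.symm
  have hmin : minpoly K f = X ^ 4 - C σ * X ^ 2 + C δ := by
    rw [← hchar]
    exact (eq_of_monic_of_dvd_of_natDegree_le (minpoly.monic (Algebra.IsIntegral.isIntegral f))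
      f.charpoly_monic f.minpoly_dvd_charpoly (by rw [f.charpoly_natDegree, hdeg])).symm
  have hbij := bijOn_ker_aeval hω hf hdeg
  rw [← encard_reflectionFactors_quartic, ← hmin, ← hbij.image_eq, hbij.injOn.encard_image]

theorem orthogonal_eq_self_iff [FiniteDimensional K V] (hω : ω.Nondegenerate)
    {P : Submodule K V} : ω.orthogonal P = P ↔
      2 * finrank K P = finrank K V ∧ ∀ x ∈ P, ∀ y ∈ P, ω x y = 0 := by
  have hfin := LinearMap.BilinForm.finrank_orthogonal hω P
  have hle := P.finrank_le
  constructor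
  · intro h
    rw [h] at hfin
    exact ⟨by lia, fun x hx y hy => h.ge hy x hx⟩
  · rintro ⟨hdim, hiso⟩
    have hP : P ≤ ω.orthogonal P := fun y hy x hx => hiso x hx y hy
    exact (Submodule.eq_of_le_of_finrank_eq hP (by lia)).symm

end LinearAlgebra

section Matrix

variable {n R : Type*} [Fintype n] [DecidableEq n] [CommRing R]

theorem charpoly_neg_comp_neg_X (A : Matrix n n R) :
    (-A).charpoly.comp (-X) = (-1) ^ Fintype.card n * A.charpoly := by
  have hmap : (compRingHom (-X)).mapMatrix (-A).charmatrix = -A.charmatrix := by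
    ext i j : 1
    by_cases hij : i = j
    · simp only [hij, RingHom.mapMatrix_apply, coe_compRingHom, map_apply, charmatrix_apply_eq,
        Matrix.neg_apply, map_neg, sub_neg_eq_add, add_comp, X_comp, C_comp, neg_sub]
      ring
    · simp [hij]
  rw [Matrix.charpoly, Matrix.charpoly, ← Matrix.det_neg, ← hmap, ← RingHom.map_det,
    coe_compRingHom_apply]

theorem charpoly_neg_of_isSkewAdjoint {J A : Matrix n n R} (hJ : IsUnit J)
    (hA : J.IsSkewAdjoint A) : (-A).charpoly = A.charpoly := by
  obtain ⟨J, rfl⟩ := hJ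
  have hconj : (J⁻¹ : (Matrix n n R)ˣ).val * Aᵀ * J.val = -A := by
    have hA' : Aᵀ * J.val = J.val * -A := hA
    rw [mul_assoc, hA', J.inv_mul_cancel_left]
  rw [← hconj, ← A.charpoly_transpose]
  simpa only [coe_units_inv] using charpoly_units_conj' J Aᵀ

theorem isUnit_toMatrix₂'_of_nondegenerate {K : Type*} [Field K]
    {B : LinearMap.BilinForm K (n → K)} (hB : B.Nondegenerate) :
    IsUnit (LinearMap.toMatrix₂' K B) :=
  (isUnit_iff_isUnit_det _).2 <| isUnit_iff_ne_zero.2 <| nondegenerate_iff_det_ne_zero.1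
    (LinearMap.nondegenerate_toMatrix₂'_iff.2 hB)

end Matrix

section Multiset

variable {R : Type*} [CommRing R] [NoZeroDivisors R] {μ ν : R}

theorem ne_zero_and_sq_ne_sq_of_nodup (h : ({μ, -μ, ν, -ν} : Multiset R).Nodup) :
    μ ≠ 0 ∧ ν ≠ 0 ∧ μ ^ 2 ≠ ν ^ 2 := by
  refine ⟨?_, ?_, fun hsq => ?_⟩
  · rintro rfl
    simp at h
  · rintro rfl
    simp at h
  · rcases sq_eq_sq_iff_eq_or_eq_neg.1 hsq with rfl | rfl <;> simp at h

theorem sq_eq_sq_of_count_eq_two [DecidableEq R] (h2 : (2 : R) ≠ 0) (hμ0 : μ ≠ 0)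
    (h : Multiset.count μ {μ, -μ, ν, -ν} = 2) : μ ^ 2 = ν ^ 2 := by
  by_contra hsq
  obtain ⟨hne, hne'⟩ := not_or.1 (mt sq_eq_sq_iff_eq_or_eq_neg.2 hsq)
  simp [ne_neg_of_two_ne_zero h2 hμ0, hne, hne'] at h

theorem ne_zero_and_sq_eq_sq_of_count_eq_two [DecidableEq R] (h2 : (2 : R) ≠ 0)
    (h : ∀ x ∈ ({μ, -μ, ν, -ν} : Multiset R), Multiset.count x {μ, -μ, ν, -ν} = 2) :
    μ ≠ 0 ∧ μ ^ 2 = ν ^ 2 := by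
  have hμ : μ ≠ 0 := by
    rintro rfl
    by_cases hν0 : ν = 0
    · simpa [hν0] using h 0 (by simp)
    · have hswap : ({0, -0, ν, -ν} : Multiset R) = {ν, -ν, 0, -0} :=
        add_comm ({0, -0} : Multiset R) {ν, -ν}
      have hsq := sq_eq_sq_of_count_eq_two h2 hν0 (hswap ▸ h ν (by simp))
      exact hν0 (by simpa using hsq)
  exact ⟨hμ, sq_eq_sq_of_count_eq_two h2 hμ (h μ (by simp))⟩

end Multiset

section Spectrum

variable {L : Matrix (Fin 4) (Fin 4) ℝ}

theorem charpoly_map_eq_prod_eigenvalues :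
    L.charpoly.map (algebraMap ℝ ℂ) = ((eigenvalues L).map fun z => X - C z).prod := by
  rw [eigenvalues, charpoly_map]
  exact (IsAlgClosed.splits _).eq_prod_roots_of_monic (L.charpoly_monic.map _)

theorem prod_map_X_sub_C_of_neg_pairs {R : Type*} [CommRing R] (μ ν : R) :
    (({μ, -μ, ν, -ν} : Multiset R).map fun z => X - C z).prod =
      X ^ 4 - C (μ ^ 2 + ν ^ 2) * X ^ 2 + C (μ ^ 2 * ν ^ 2) := by
  simp only [Multiset.insert_eq_cons, Multiset.map_cons, Multiset.map_singleton,
    Multiset.prod_cons, Multiset.prod_singleton, C_neg, C_add, C_mul, C_pow]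
  ring

theorem charpoly_eq_quartic {μ ν : ℂ} (h : eigenvalues L = {μ, -μ, ν, -ν}) {σ δ : ℝ}
    (hσ : μ ^ 2 + ν ^ 2 = σ) (hδ : μ ^ 2 * ν ^ 2 = δ) :
    L.charpoly = X ^ 4 - C σ * X ^ 2 + C δ := by
  refine map_injective _ (algebraMap ℝ ℂ).injective ?_
  rw [charpoly_map_eq_prod_eigenvalues, h, prod_map_X_sub_C_of_neg_pairs, hσ, hδ]
  simp

theorem exists_eigenvalues_eq_of_charpoly_eq_quartic {σ δ : ℝ}
    (h : L.charpoly = X ^ 4 - C σ * X ^ 2 + C δ) :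
    ∃ μ ν : ℂ, eigenvalues L = {μ, -μ, ν, -ν} := by
  obtain ⟨d, hd⟩ := IsAlgClosed.exists_pow_nat_eq ((σ : ℂ) ^ 2 - 4 * δ) two_pos
  obtain ⟨μ, hμ⟩ := IsAlgClosed.exists_pow_nat_eq ((σ + d) / 2) two_pos
  obtain ⟨ν, hν⟩ := IsAlgClosed.exists_pow_nat_eq ((σ - d) / 2) two_pos
  have hσ : (σ : ℂ) = μ ^ 2 + ν ^ 2 := by rw [hμ, hν]; ring
  have hδ : (δ : ℂ) = μ ^ 2 * ν ^ 2 := by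
    rw [hμ, hν]
    linear_combination (1 / 4 : ℂ) * hd
  refine ⟨μ, ν, ?_⟩
  rw [eigenvalues, charpoly_map, h, ← roots_multiset_prod_X_sub_C {μ, -μ, ν, -ν},
    prod_map_X_sub_C_of_neg_pairs, ← hσ, ← hδ]
  simp

theorem sq_eq_of_mem_eigenvalues {c : ℝ} (h : toLin' L * toLin' L = c • 1) {μ : ℂ}
    (hμ : μ ∈ eigenvalues L) : μ ^ 2 = c := by
  have hL : L ^ 2 = algebraMap ℝ _ c := toLin'.injective <| by
    rw [sq, toLin'_mul, Algebra.algebraMap_eq_smul_one, map_smul, toLin'_one]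
    exact h
  have hLC : L.map (algebraMap ℝ ℂ) ^ 2 = algebraMap ℂ _ (c : ℂ) := by
    have hmap := congrArg (algebraMap ℝ ℂ).mapMatrix hL
    rw [map_pow] at hmap
    refine hmap.trans ?_
    ext i j
    by_cases hij : i = j <;> simp [algebraMap_matrix_apply, hij]
  have hspec : μ ∈ spectrum ℂ (L.map (algebraMap ℝ ℂ)) :=
    mem_spectrum_iff_isRoot_charpoly.2 (isRoot_of_mem_roots hμ)
  have hpow := spectrum.pow_mem_pow _ 2 hspec
  rwa [hLC, spectrum.scalar_eq] at hpow

theorem sq_ne_smul_one_of_hasNonzeroNilpotentPart (h : HasNonzeroNilpotentPart L) {c : ℝ}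
    (hc : c ≠ 0) : toLin' L * toLin' L ≠ c • 1 := by
  intro hL
  obtain ⟨s, n, hs, hn, hsn, hsum, hn0⟩ := h
  have hss : End.IsSemisimple (toLin' L) := by
    refine End.isSemisimple_of_squarefree_aeval_eq_zero
      (separable_X_pow_sub_C (n := 2) c (by norm_num) hc).squarefree ?_
    rw [map_sub, map_pow, aeval_X, aeval_C, sq, hL, Algebra.algebraMap_eq_smul_one, sub_self]
  have hcomm : Commute (toLin' L) s := hsum ▸ (Commute.refl s).add_left hsn.symm
  have hnss : n.IsSemisimple := by
    rw [eq_sub_of_add_eq' hsum.symm]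
    exact hss.sub_of_commute hcomm hs
  exact hn0 (End.eq_zero_of_isNilpotent_isSemisimple hn hnss)

theorem sq_eq_neg_im_sq {z : ℂ} (hz : z.re = 0) : z ^ 2 = ((-z.im ^ 2 : ℝ) : ℂ) := by
  apply Complex.ext <;> simp [sq, hz]

theorem sq_eq_re_sq {z : ℂ} (hz : z.im = 0) : z ^ 2 = ((z.re ^ 2 : ℝ) : ℂ) := by
  apply Complex.ext <;> simp [sq, hz]

theorem mul_self_ne_smul_one_of_sq_ne_sq {μ ν : ℂ} (hμ : μ ∈ eigenvalues L)
    (hν : ν ∈ eigenvalues L) (hne : μ ^ 2 ≠ ν ^ 2) (c : ℝ) : toLin' L * toLin' L ≠ c • 1 :=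
  fun hL => hne ((sq_eq_of_mem_eigenvalues hL hμ).trans (sq_eq_of_mem_eigenvalues hL hν).symm)

theorem HasSimpleEigenvalues.ne_zero_and_sq_ne_sq {μ ν : ℂ} (hsimple : HasSimpleEigenvalues L)
    (h : eigenvalues L = {μ, -μ, ν, -ν}) : μ ≠ 0 ∧ ν ≠ 0 ∧ μ ^ 2 ≠ ν ^ 2 := by
  rw [HasSimpleEigenvalues, h] at hsimple
  exact ne_zero_and_sq_ne_sq_of_nodup hsimple

theorem HasDoubleEigenvalues.ne_zero_and_sq_eq_sq {μ ν : ℂ} (hdouble : HasDoubleEigenvalues L)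
    (h : eigenvalues L = {μ, -μ, ν, -ν}) : μ ≠ 0 ∧ μ ^ 2 = ν ^ 2 := by
  rw [HasDoubleEigenvalues, h] at hdouble
  exact ne_zero_and_sq_eq_sq_of_count_eq_two two_ne_zero hdouble

end Spectrum

section Hamiltonian

variable {ω : LinearMap.BilinForm ℝ (Fin 4 → ℝ)} {H : QuadraticForm ℝ (Fin 4 → ℝ)}

theorem apply_systemMatrix (hω : ω.Nondegenerate) (x y : Fin 4 → ℝ) :
    ω x (toLin' (systemMatrix ω H) y) = QuadraticMap.associated (R := ℝ) H x y := by
  rw [← toLinearMap₂'_toMatrix' (R := ℝ) ω,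
    ← toLinearMap₂'_toMatrix' (R := ℝ) (QuadraticMap.associated (R := ℝ) H),
    toLinearMap₂'_apply', toLinearMap₂'_apply', toLin'_apply, mulVec_mulVec,
    toLinearMap₂'_toMatrix' (R := ℝ) ω, systemMatrix,
    mul_nonsing_inv_cancel_left _ _ ((isUnit_iff_isUnit_det _).1
      (isUnit_toMatrix₂'_of_nondegenerate hω))]
  rfl

theorem isSkewAdjoint_systemMatrix (hω_alt : ω.IsAlt) (hω : ω.Nondegenerate) :
    ω.IsSkewAdjoint (toLin' (systemMatrix ω H)) := fun x y => by
  rw [← hω_alt.neg_eq, Pi.neg_apply, map_neg, apply_systemMatrix hω, apply_systemMatrix hω, neg_inj]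
  exact QuadraticMap.associated_isSymm ℝ H y x

theorem charpoly_systemMatrix_dvd_comp_neg_X (hω_alt : ω.IsAlt) (hω : ω.Nondegenerate) :
    (systemMatrix ω H).charpoly ∣ (systemMatrix ω H).charpoly.comp (-X) := by
  have hskew : (LinearMap.toMatrix₂' ℝ ω).IsSkewAdjoint (systemMatrix ω H) := by
    refine (isAdjointPair_toLinearMap₂' _ _ _ _).1 ?_
    rw [toLinearMap₂'_toMatrix', map_neg]
    exact isSkewAdjoint_systemMatrix hω_alt hω
  have h := charpoly_neg_comp_neg_X (systemMatrix ω H)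
  rw [charpoly_neg_of_isSkewAdjoint (isUnit_toMatrix₂'_of_nondegenerate hω) hskew] at h
  exact h ▸ dvd_mul_left _ _

theorem exists_eigenvalues_systemMatrix_eq (hω_alt : ω.IsAlt) (hω : ω.Nondegenerate) :
    ∃ μ ν : ℂ, eigenvalues (systemMatrix ω H) = {μ, -μ, ν, -ν} :=
  exists_eigenvalues_eq_of_charpoly_eq_quartic <|
    eq_quartic_of_monic_of_dvd_comp_neg_X two_ne_zero (charpoly_monic _) (by simp)
      (charpoly_systemMatrix_dvd_comp_neg_X hω_alt hω)

theorem isLagrangianPlane_iff (hω : ω.Nondegenerate) {P : Submodule ℝ (Fin 4 → ℝ)} :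
    IsLagrangianPlane ω P ↔ ω.orthogonal P = P := by
  rw [orthogonal_eq_self_iff hω, IsLagrangianPlane, finrank_fin_fun]
  exact and_congr_left' (by lia)

theorem subset_nullCone_iff_mem_invtSubmodule (hω : ω.Nondegenerate)
    {P : Submodule ℝ (Fin 4 → ℝ)} (hP : ω.orthogonal P = P) :
    (P : Set (Fin 4 → ℝ)) ⊆ nullCone H ↔ P ∈ End.invtSubmodule (toLin' (systemMatrix ω H)) := by
  constructor
  · intro hnull x hx
    change toLin' (systemMatrix ω H) x ∈ P
    rw [← hP]
    intro y hy
    have hxH : H x = 0 := hnull hx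
    have hyH : H y = 0 := hnull hy
    have hxyH : H (y + x) = 0 := hnull (P.add_mem hy hx)
    refine (apply_systemMatrix hω y x).trans ?_
    rw [QuadraticMap.associated_apply, hxH, hyH, hxyH]
    simp
  · intro hinv x hx
    have h : ω x (toLin' (systemMatrix ω H) x) = 0 := hP.ge (hinv hx) x hx
    rwa [apply_systemMatrix hω, QuadraticMap.associated_eq_self_apply] at h

theorem lagrangianPlanesInNullCone_eq (hω : ω.Nondegenerate) :
    lagrangianPlanesInNullCone ω H =
      lagrangianInvtSubmodules ω (toLin' (systemMatrix ω H)) := by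
  ext P
  rw [lagrangianPlanesInNullCone, Set.mem_ofPred_eq, isLagrangianPlane_iff hω, and_comm]
  exact and_congr_left fun hP => subset_nullCone_iff_mem_invtSubmodule hω hP

theorem encard_lagrangianPlanesInNullCone (hω_alt : ω.IsAlt) (hω : ω.Nondegenerate) {μ ν : ℂ}
    (h : eigenvalues (systemMatrix ω H) = {μ, -μ, ν, -ν}) (hμ : μ ≠ 0) (hν : ν ≠ 0)
    (hsq : ∀ c : ℝ, c ≠ 0 → toLin' (systemMatrix ω H) * toLin' (systemMatrix ω H) ≠ c • 1)
    {σ δ : ℝ} (hσ : μ ^ 2 + ν ^ 2 = σ) (hδ : μ ^ 2 * ν ^ 2 = δ) :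
    (lagrangianPlanesInNullCone ω H).encard = (quarticReflectionFactors σ δ).encard := by
  have hδ0 : δ ≠ 0 := by
    rintro rfl
    exact mul_ne_zero (pow_ne_zero 2 hμ) (pow_ne_zero 2 hν) (by simpa using hδ)
  rw [lagrangianPlanesInNullCone_eq hω]
  refine encard_lagrangianInvtSubmodules two_ne_zero (by simp) hω
    (isSkewAdjoint_systemMatrix hω_alt hω) ?_ hδ0 hsq
  rw [charpoly_toLin', charpoly_eq_quartic h hσ hδ]

theorem encard_lagrangianPlanesInNullCone_of_hasSimpleEigenvalues (hω_alt : ω.IsAlt)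
    (hω : ω.Nondegenerate) (hsimple : HasSimpleEigenvalues (systemMatrix ω H)) {μ ν : ℂ}
    (h : eigenvalues (systemMatrix ω H) = {μ, -μ, ν, -ν}) {a b : ℝ} (ha : μ ^ 2 = a)
    (hb : ν ^ 2 = b) :
    (lagrangianPlanesInNullCone ω H).encard =
      (quarticReflectionFactors (a + b) (a * b)).encard := by
  obtain ⟨hμ0, hν0, hne⟩ := hsimple.ne_zero_and_sq_ne_sq h
  exact encard_lagrangianPlanesInNullCone hω_alt hω h hμ0 hν0
    (fun c _ => mul_self_ne_smul_one_of_sq_ne_sq (by simp [h]) (by simp [h]) hne c)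
    (by rw [ha, hb, Complex.ofReal_add]) (by rw [ha, hb, Complex.ofReal_mul])

theorem encard_lagrangianPlanesInNullCone_of_hasDoubleEigenvalues (hω_alt : ω.IsAlt)
    (hω : ω.Nondegenerate) (hdouble : HasDoubleEigenvalues (systemMatrix ω H))
    (hnil : HasNonzeroNilpotentPart (systemMatrix ω H)) {μ ν : ℂ}
    (h : eigenvalues (systemMatrix ω H) = {μ, -μ, ν, -ν}) {a : ℝ} (ha : μ ^ 2 = a) :
    (lagrangianPlanesInNullCone ω H).encard =
      (quarticReflectionFactors (a + a) (a * a)).encard := by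
  obtain ⟨hμ0, heq⟩ := hdouble.ne_zero_and_sq_eq_sq h
  have hν0 : ν ≠ 0 := (pow_ne_zero_iff two_ne_zero).1 (heq ▸ pow_ne_zero 2 hμ0)
  exact encard_lagrangianPlanesInNullCone hω_alt hω h hμ0 hν0
    (fun _ => sq_ne_smul_one_of_hasNonzeroNilpotentPart hnil)
    (by rw [← heq, ha, Complex.ofReal_add]) (by rw [← heq, ha, Complex.ofReal_mul])

theorem encard_eq_zero_of_isElliptic_of_hasSimpleEigenvalues (hω_alt : ω.IsAlt)
    (hω : ω.Nondegenerate) (helliptic : IsElliptic (systemMatrix ω H))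
    (hsimple : HasSimpleEigenvalues (systemMatrix ω H)) :
    (lagrangianPlanesInNullCone ω H).encard = 0 := by
  obtain ⟨μ, ν, h⟩ := exists_eigenvalues_systemMatrix_eq (H := H) hω_alt hω
  obtain ⟨-, -, hne⟩ := hsimple.ne_zero_and_sq_ne_sq h
  have hμ : μ ^ 2 = ((-μ.im ^ 2 : ℝ) : ℂ) := sq_eq_neg_im_sq (helliptic μ (by simp [h]))
  have hν : ν ^ 2 = ((-ν.im ^ 2 : ℝ) : ℂ) := sq_eq_neg_im_sq (helliptic ν (by simp [h]))
  have him : μ.im ^ 2 ≠ ν.im ^ 2 := fun heq => hne (by rw [hμ, hν, heq])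
  rw [encard_lagrangianPlanesInNullCone_of_hasSimpleEigenvalues hω_alt hω hsimple h hμ hν,
    quarticReflectionFactors_neg_sq_eq_empty him, Set.encard_empty]

theorem encard_eq_one_of_isElliptic_of_hasDoubleEigenvalues (hω_alt : ω.IsAlt)
    (hω : ω.Nondegenerate) (helliptic : IsElliptic (systemMatrix ω H))
    (hdouble : HasDoubleEigenvalues (systemMatrix ω H))
    (hnil : HasNonzeroNilpotentPart (systemMatrix ω H)) :
    (lagrangianPlanesInNullCone ω H).encard = 1 := by
  obtain ⟨μ, ν, h⟩ := exists_eigenvalues_systemMatrix_eq (H := H) hω_alt hω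
  obtain ⟨hμ0, -⟩ := hdouble.ne_zero_and_sq_eq_sq h
  have hre : μ.re = 0 := helliptic μ (by simp [h])
  have him : μ.im ≠ 0 := fun him => hμ0 (Complex.ext hre him)
  rw [encard_lagrangianPlanesInNullCone_of_hasDoubleEigenvalues hω_alt hω hdouble hnil h
    (sq_eq_neg_im_sq hre), quarticReflectionFactors_neg_sq him, Set.encard_singleton]

theorem encard_eq_two_of_hasComplexQuadruplet (hω_alt : ω.IsAlt) (hω : ω.Nondegenerate)
    (hquad : HasComplexQuadruplet (systemMatrix ω H)) :
    (lagrangianPlanesInNullCone ω H).encard = 2 := by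
  obtain ⟨κ, ν, hκ, hν, heigen⟩ := hquad
  let z : ℂ := ⟨κ, ν⟩
  let w : ℂ := ⟨κ, -ν⟩
  have hz : z = κ + ν * Complex.I := Complex.mk_eq_add_mul_I κ ν
  have hw : w = κ - ν * Complex.I := by
    simpa [sub_eq_add_neg] using Complex.mk_eq_add_mul_I κ (-ν)
  have hneg_z : -z = ⟨-κ, -ν⟩ := rfl
  have hneg_w : -w = ⟨-κ, ν⟩ := Complex.ext rfl (neg_neg ν)
  have h : eigenvalues (systemMatrix ω H) = {z, -z, w, -w} :=
    calc eigenvalues (systemMatrix ω H)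
        = z ::ₘ ({w, -w} + {-z}) := by rw [heigen, hneg_z, hneg_w]; rfl
      _ = {z, -z, w, -w} := by rw [add_comm]; rfl
  have hne : z ^ 2 ≠ w ^ 2 := by
    intro hzw
    rcases sq_eq_sq_iff_eq_or_eq_neg.1 hzw with hzw | hzw
    · exact ne_neg_of_two_ne_zero two_ne_zero hν (congrArg Complex.im hzw)
    · exact ne_neg_of_two_ne_zero two_ne_zero hκ (congrArg Complex.re hzw)
  have hz0 : z ≠ 0 := fun hz => hκ (congrArg Complex.re hz)
  have hw0 : w ≠ 0 := fun hw => hκ (congrArg Complex.re hw)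
  rw [encard_lagrangianPlanesInNullCone hω_alt hω h hz0 hw0
    (fun c _ => mul_self_ne_smul_one_of_sq_ne_sq (by simp [h]) (by simp [h]) hne c)
    (σ := 2 * (κ ^ 2 - ν ^ 2)) (δ := (κ ^ 2 + ν ^ 2) ^ 2) ?_ ?_,
    encard_quarticReflectionFactors_eq_two hκ hν]
  · rw [hz, hw]
    push_cast
    linear_combination 2 * (ν : ℂ) ^ 2 * Complex.I_sq
  · rw [hz, hw]
    push_cast
    linear_combination
      -(ν : ℂ) ^ 2 * (2 * κ ^ 2 + ν ^ 2 - ν ^ 2 * Complex.I ^ 2) * Complex.I_sq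

theorem encard_eq_three_of_hasRealEigenvalues_of_hasDoubleEigenvalues (hω_alt : ω.IsAlt)
    (hω : ω.Nondegenerate) (hreal : HasRealEigenvalues (systemMatrix ω H))
    (hdouble : HasDoubleEigenvalues (systemMatrix ω H))
    (hnil : HasNonzeroNilpotentPart (systemMatrix ω H)) :
    (lagrangianPlanesInNullCone ω H).encard = 3 := by
  obtain ⟨μ, ν, h⟩ := exists_eigenvalues_systemMatrix_eq (H := H) hω_alt hω
  obtain ⟨hμ0, -⟩ := hdouble.ne_zero_and_sq_eq_sq h
  have him : μ.im = 0 := hreal μ (by simp [h])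
  have hre : μ.re ≠ 0 := fun hre => hμ0 (Complex.ext hre him)
  rw [encard_lagrangianPlanesInNullCone_of_hasDoubleEigenvalues hω_alt hω hdouble hnil h
    (sq_eq_re_sq him), encard_quarticReflectionFactors_eq_three two_ne_zero hre]

theorem encard_eq_four_of_hasRealEigenvalues_of_hasSimpleEigenvalues (hω_alt : ω.IsAlt)
    (hω : ω.Nondegenerate) (hreal : HasRealEigenvalues (systemMatrix ω H))
    (hsimple : HasSimpleEigenvalues (systemMatrix ω H)) :
    (lagrangianPlanesInNullCone ω H).encard = 4 := by
  obtain ⟨μ, ν, h⟩ := exists_eigenvalues_systemMatrix_eq (H := H) hω_alt hω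
  obtain ⟨hμ0, hν0, hne⟩ := hsimple.ne_zero_and_sq_ne_sq h
  have hμim : μ.im = 0 := hreal μ (by simp [h])
  have hνim : ν.im = 0 := hreal ν (by simp [h])
  have hμre : μ.re ≠ 0 := fun hre => hμ0 (Complex.ext hre hμim)
  have hνre : ν.re ≠ 0 := fun hre => hν0 (Complex.ext hre hνim)
  have hre : μ.re ^ 2 ≠ ν.re ^ 2 := fun heq =>
    hne (by rw [sq_eq_re_sq hμim, sq_eq_re_sq hνim, heq])
  rw [encard_lagrangianPlanesInNullCone_of_hasSimpleEigenvalues hω_alt hω hsimple h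
    (sq_eq_re_sq hμim) (sq_eq_re_sq hνim),
    encard_quarticReflectionFactors_eq_four two_ne_zero hμre hνre hre]

end Hamiltonian

end LinHam

theorem theorem1_general (ω : LinearMap.BilinForm ℝ (Fin 4 → ℝ))
    (H : QuadraticForm ℝ (Fin 4 → ℝ)) (hω_alt : ω.IsAlt) (hω_nondeg : ω.Nondegenerate) :
    (LinHam.IsElliptic (LinHam.systemMatrix ω H) →
      LinHam.HasSimpleEigenvalues (LinHam.systemMatrix ω H) →
      (LinHam.lagrangianPlanesInNullCone ω H).encard = 0) ∧
    (LinHam.IsElliptic (LinHam.systemMatrix ω H) →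
      LinHam.HasDoubleEigenvalues (LinHam.systemMatrix ω H) →
      LinHam.HasNonzeroNilpotentPart (LinHam.systemMatrix ω H) →
      (LinHam.lagrangianPlanesInNullCone ω H).encard = 1) ∧
    (LinHam.HasComplexQuadruplet (LinHam.systemMatrix ω H) →
      (LinHam.lagrangianPlanesInNullCone ω H).encard = 2) ∧
    (LinHam.HasRealEigenvalues (LinHam.systemMatrix ω H) →
      LinHam.HasDoubleEigenvalues (LinHam.systemMatrix ω H) →
      LinHam.HasNonzeroNilpotentPart (LinHam.systemMatrix ω H) →
      (LinHam.lagrangianPlanesInNullCone ω H).encard = 3) ∧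
    (LinHam.HasRealEigenvalues (LinHam.systemMatrix ω H) →
      LinHam.HasSimpleEigenvalues (LinHam.systemMatrix ω H) →
      (LinHam.lagrangianPlanesInNullCone ω H).encard = 4) :=
  ⟨LinHam.encard_eq_zero_of_isElliptic_of_hasSimpleEigenvalues hω_alt hω_nondeg,
    LinHam.encard_eq_one_of_isElliptic_of_hasDoubleEigenvalues hω_alt hω_nondeg,
    LinHam.encard_eq_two_of_hasComplexQuadruplet hω_alt hω_nondeg,
    LinHam.encard_eq_three_of_hasRealEigenvalues_of_hasDoubleEigenvalues hω_alt hω_nondeg,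
    LinHam.encard_eq_four_of_hasRealEigenvalues_of_hasSimpleEigenvalues hω_alt hω_nondeg⟩

theorem theorem1 (ω : LinearMap.BilinForm ℝ (Fin 4 → ℝ)) (H : QuadraticForm ℝ (Fin 4 → ℝ))
    (hω_alt : ω.IsAlt) (hω_nondeg : ω.Nondegenerate)
    (hH_nondeg : H.toMatrix'.det ≠ 0)
    (hH_sig : sigPos H = sigNeg H) :
    (LinHam.IsElliptic (LinHam.systemMatrix ω H) →
      LinHam.HasSimpleEigenvalues (LinHam.systemMatrix ω H) →
      (LinHam.lagrangianPlanesInNullCone ω H).encard = 0) ∧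
    (LinHam.IsElliptic (LinHam.systemMatrix ω H) →
      LinHam.HasDoubleEigenvalues (LinHam.systemMatrix ω H) →
      LinHam.HasNonzeroNilpotentPart (LinHam.systemMatrix ω H) →
      (LinHam.lagrangianPlanesInNullCone ω H).encard = 1) ∧
    (LinHam.IsHyperbolic (LinHam.systemMatrix ω H) →
      LinHam.HasComplexQuadruplet (LinHam.systemMatrix ω H) →
      (LinHam.lagrangianPlanesInNullCone ω H).encard = 2) ∧
    (LinHam.IsHyperbolic (LinHam.systemMatrix ω H) →
      LinHam.HasRealEigenvalues (LinHam.systemMatrix ω H) →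
      LinHam.HasDoubleEigenvalues (LinHam.systemMatrix ω H) →
      LinHam.HasNonzeroNilpotentPart (LinHam.systemMatrix ω H) →
      (LinHam.lagrangianPlanesInNullCone ω H).encard = 3) ∧
    (LinHam.IsHyperbolic (LinHam.systemMatrix ω H) →
      LinHam.HasRealEigenvalues (LinHam.systemMatrix ω H) →
      LinHam.HasSimpleEigenvalues (LinHam.systemMatrix ω H) →
      (LinHam.lagrangianPlanesInNullCone ω H).encard = 4) := by
  obtain ⟨h0, h1, h2, h3, h4⟩ := theorem1_general ω H hω_alt hω_nondeg
  exact ⟨h0, h1, fun _ => h2, fun _ => h3, fun _ => h4⟩
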